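/- Let $n\ge 1$ and let $G$ be an irreducible, essential (finite, real) reflection group acting on $V=\mathbb{R}^n$ by orthogonal transformations; that is, $G$ is a finite group of orthogonal transformations generated by reflections, it fixes no nonzero vector, and it is not the product of two nontrivial reflection groups. For a reflection group $G'$ on $V$ (the trivial group included) let $d_n(G')$ be the largest degree of a basic invariant of $G'$, i.e. the largest degree among homogeneous, algebraically independent polynomials $\pi_1,\dots,\pi_n\in\mathbb{R}[V]$ that generate $\mathbb{R}[V]^{G'}$. Let $\mathcal{H}_i(G)$ be the set of points of $V$ that are contained in some $i$-dimensional intersection of reflection hyperplanes of $G$ (so $\mathcal{H}_n(G)=V$). A point is called $G'$-general if it lies on no reflection hyperplane of $G'$. For an integer $d\ge 0$ let $\ell(d)$ be the smallest integer $\ell\ge 0$ such that for every $p\in V\setminus\mathcal{H}_{\ell}(G)$ there is a reflection subgroup $G'\subseteq G$ such that $p$ is $G'$-general and $2d_n(G')>d$. Let $\Delta$ be a simple system in the root system formed by the unit normals of the reflection hyperplanes of $G$, let $W_I$ denote the standard parabolic subgroup generated by the reflections $s_\alpha$, $\alpha\in I$, and put $$ p(d) \;=\; \min\{\, |I|-1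 \;:\; \emptyset\ne I\subseteq\Delta,\ 2d_n(W_I)>d \,\}, $$ with $p(d)=\infty$ if there is no such $I$. Then $\ell(d)\le p(d)$ for every integer $d\ge 0$. -/

import Mathlib

namespace ReflGrp

/-- The Euclidean space `ℝⁿ`. -/
abbrev E (n : ℕ) : Type := EuclideanSpace ℝ (Fin n)

/-- The group `O(ℝⁿ)` of orthogonal transformations. -/
abbrev O (n : ℕ) : Type := E n ≃ₗᵢ[ℝ] E n

variable {n : ℕ}

/-- The orthogonal reflection `s_α` in the hyperplane `α^⊥` (used only for `α ≠ 0`). -/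
noncomputable def refl (α : E n) : O n := (Submodule.span ℝ {α})ᗮ.reflection

/-- `g` is a reflection: it is the orthogonal reflection in some linear hyperplane. -/
def IsReflection (g : O n) : Prop := ∃ α : E n, α ≠ 0 ∧ g = refl α

/-- A reflection group: a finite group of orthogonal transformations that is generated by
reflections. The trivial group is one (generated by the empty set). -/
def IsReflectionGroup (G : Subgroup (O n)) : Prop :=
  Finite G ∧ Subgroup.closure {g : O n | g ∈ G ∧ IsReflection g} = G

/-- `G` is essential: it fixes no nonzero vector. -/
def IsEssential (G : Subgroup (O n)) : Prop :=
  ∀ v : E n, (∀ g ∈ G, g v = v) → v = 0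

/-- `G` is irreducible: it is not the (internal direct) product of two nontrivial
reflection groups. -/
def IsIrreducible (G : Subgroup (O n)) : Prop :=
  ¬ ∃ G₁ G₂ : Subgroup (O n),
      IsReflectionGroup G₁ ∧ IsReflectionGroup G₂ ∧ G₁ ≠ ⊥ ∧ G₂ ≠ ⊥ ∧
      (∀ g ∈ G₁, ∀ h ∈ G₂, g * h = h * g) ∧ G₁ ⊓ G₂ = ⊥ ∧ G₁ ⊔ G₂ = G

/-- The roots of `G`: the unit normal vectors of the reflection hyperplanes of `G`. -/
def roots (G : Subgroup (O n)) : Set (E n) := {α | ‖α‖ = 1 ∧ refl α ∈ G}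

/-- The reflection arrangement of `G`: the fixed hyperplanes of the reflections in `G`. -/
def arrangement (G : Subgroup (O n)) : Set (Submodule ℝ (E n)) :=
  {H | ∃ α : E n, α ≠ 0 ∧ refl α ∈ G ∧ H = (Submodule.span ℝ {α})ᗮ}

/-- The flats of the arrangement: all intersections of reflection hyperplanes (the empty
intersection being the whole space). -/
def flats (G : Subgroup (O n)) : Set (Submodule ℝ (E n)) :=
  {F | ∃ S : Set (Submodule ℝ (E n)), S ⊆ arrangement G ∧ F = sInf S}

/-- The stratum `ℋ_i(G)`: the points contained in a flat of dimension `i`. -/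
def stratum (G : Subgroup (O n)) (i : ℕ) : Set (E n) :=
  {p | ∃ F ∈ flats G, Module.finrank ℝ F = i ∧ p ∈ F}

/-- `p` is `G`-general: it lies on no reflection hyperplane of `G`. -/
def IsGeneral (G : Subgroup (O n)) (p : E n) : Prop := ∀ H ∈ arrangement G, p ∉ H

/-- The ring of invariants `ℝ[V]^G`. (A real polynomial is determined by its values, so
invariance can be tested on points.) -/
noncomputable def invariants (G : Subgroup (O n)) : Subalgebra ℝ (MvPolynomial (Fin n) ℝ) where
  carrier := {f | ∀ g ∈ G, ∀ x : E n,
    MvPolynomial.eval (fun i => (g x) i) f = MvPolynomial.eval (fun i => x i) f}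
  mul_mem' := by
    intro a b ha hb g hg x
    rw [map_mul, map_mul, ha g hg x, hb g hg x]
  add_mem' := by
    intro a b ha hb g hg x
    rw [map_add, map_add, ha g hg x, hb g hg x]
  algebraMap_mem' := by
    intro r g _ x
    simp [MvPolynomial.algebraMap_eq]

/-- `π₁, …, π_n` is a set of basic invariants of `G`: algebraically independent homogeneous
polynomials that generate the ring of invariants. -/
structure IsBasicInvariants (G : Subgroup (O n)) (π : Fin n → MvPolynomial (Fin n) ℝ) :
    Prop where
  homogeneous : ∀ i, (π i).IsHomogeneous (π i).totalDegree
  algebraicIndependent : AlgebraicIndependent ℝ π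
  generate : Algebra.adjoin ℝ (Set.range π) = invariants G

/-- `d_n(G)`, the largest degree of a basic invariant of `G` (as a group acting on all of `ℝⁿ`).
The degrees do not depend on the choice of the basic invariants, so that the supremum is over
a nonempty finite set whenever `G` is a reflection group on `ℝⁿ` and `n ≥ 1`. -/
noncomputable def topDegree (G : Subgroup (O n)) : ℕ :=
  sSup {e | ∃ π : Fin n → MvPolynomial (Fin n) ℝ,
    IsBasicInvariants G π ∧ ∃ i, e = (π i).totalDegree}

/-- `ℓ(d)`: the smallest `ℓ ≥ 0` such that for every point `p` outside `ℋ_ℓ(G)` there is a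
reflection subgroup `G' ⊆ G` such that `p` is `G'`-general and `2 d_n(G') > d`.
(The set is nonempty: it contains `n`, because `ℋ_n(G)` is the whole space.) -/
noncomputable def strataNumber (G : Subgroup (O n)) (d : ℕ) : ℕ :=
  sInf {l : ℕ | ∀ p : E n, p ∉ stratum G l →
    ∃ G' : Subgroup (O n), G' ≤ G ∧ IsReflectionGroup G' ∧ IsGeneral G' p ∧
      d < 2 * topDegree G'}

/-- `Δ` is a simple system for `G`: a linearly independent set of roots such that every root
is a linear combination of `Δ` with all coefficients nonnegative or all nonpositive. -/
structure IsSimpleSystem (G : Subgroup (O n)) (Δ : Finset (E n)) : Prop where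
  subset_roots : ∀ α ∈ Δ, α ∈ roots G
  linearIndependent : LinearIndependent ℝ (fun α : Δ => (α : E n))
  combination : ∀ β ∈ roots G, ∃ c : E n → ℝ,
    β = ∑ α ∈ Δ, c α • α ∧ ((∀ α ∈ Δ, 0 ≤ c α) ∨ (∀ α ∈ Δ, c α ≤ 0))

/-- The standard parabolic subgroup `W_I`, generated by the reflections `s_α`, `α ∈ I`. -/
noncomputable def parabolic (I : Finset (E n)) : Subgroup (O n) :=
  Subgroup.closure {g : O n | ∃ α ∈ I, g = refl α}

/-- `p(d) = min {|I| - 1 : ∅ ≠ I ⊆ Δ, 2 d_n(W_I) > d}`, with value `⊤` if there is no such `I`.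
Since `I` is nonempty, the subtraction is not truncated. -/
noncomputable def parabolicNumber (Δ : Finset (E n)) (d : ℕ) : ℕ∞ :=
  sInf {m : ℕ∞ | ∃ I : Finset (E n), I ⊆ Δ ∧ I.Nonempty ∧ d < 2 * topDegree (parabolic I) ∧
    m = ((I.card - 1 : ℕ) : ℕ∞)}

end ReflGrp

namespace ReflGrp

variable {n : ℕ}

/-! Given a nonempty `I ⊆ Δ` with `d < 2 * topDegree (parabolic I)`, it suffices that `|I| - 1`
qualifies in the definition of `strataNumber`. If `p` lies outside that stratum, its minimal flat
has dimension at least `|I|`, because flats through `p` lose dimension one at a time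
(`lt_finrank_minimalFlat`). The core is `exists_inner_map_ne_zero`: some `g ∈ G` moves `p` off every
hyperplane with normal in `span I`. Then `p` is general for `g⁻¹ W_I g`, which has the same degrees
as `W_I` (`topDegree_conjSubgroup`). To find `g`, minimize the set of normals in `span I` orthogonal
to `g p`. If one is left, a dimension count and irreducibility supply a reflection that strictly
shrinks the set. -/

theorem refl_apply (α x : E n) :
    refl α x = x - (2 * inner ℝ α x / ‖α‖ ^ 2) • α := by
  rw [refl, Submodule.reflection_orthogonal_apply, Submodule.reflection_singleton_apply,
    neg_sub]
  rw [two_smul, ← add_smul]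
  congr 2
  simp only [RCLike.ofReal_real_eq_id, id]
  ring

theorem refl_apply_eq_self_iff {α : E n} (hα : α ≠ 0) (x : E n) :
    refl α x = x ↔ inner ℝ α x = 0 := by
  rw [refl_apply, sub_eq_self, smul_eq_zero]
  simp [hα]

theorem refl_ne_one {α : E n} (hα : α ≠ 0) : refl α ≠ 1 := by
  intro h
  have := (refl_apply_eq_self_iff hα α).1 (by rw [h]; rfl)
  exact hα (inner_self_eq_zero.1 this)

theorem refl_map (g : O n) (α : E n) : refl (g α) = g * refl α * g⁻¹ := by
  ext1 x
  have hx : g (g⁻¹ x) = x := g.apply_symm_apply x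
  have hi : inner ℝ (g α) x = inner ℝ α (g⁻¹ x) := by
    rw [← g.inner_map_map α, hx]
  change _ = g (refl α (g⁻¹ x))
  rw [refl_apply, refl_apply, map_sub, map_smul, hx, hi, g.norm_map]

theorem refl_inner_comm (α x y : E n) : inner ℝ (refl α x) y = inner ℝ x (refl α y) := by
  rw [refl_apply, refl_apply, inner_sub_left, inner_sub_right, inner_smul_left, inner_smul_right,
    real_inner_comm x α]
  simp only [conj_trivial]
  ring

theorem mem_orthogonal_span_singleton (α p : E n) :
    p ∈ (Submodule.span ℝ {α})ᗮ ↔ inner ℝ α p = 0 :=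
  Submodule.mem_orthogonal_singleton_iff_inner_right

/-- The nonzero normal vectors of the reflection hyperplanes of `G`. -/
def normals (G : Subgroup (O n)) : Set (E n) := {α | α ≠ 0 ∧ refl α ∈ G}

theorem map_mem_normals {G : Subgroup (O n)} {g : O n} (hg : g ∈ G) {α : E n}
    (hα : α ∈ normals G) : g α ∈ normals G :=
  ⟨fun h => hα.1 (g.map_eq_zero_iff.1 h), by
    rw [refl_map]; exact G.mul_mem (G.mul_mem hg hα.2) (G.inv_mem hg)⟩

/-- The group generated by the reflections with normals in `S`. -/
noncomputable def reflClosure (S : Set (E n)) : Subgroup (O n) :=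
  Subgroup.closure (refl '' S)

theorem reflClosure_fixes {S : Set (E n)} {v : E n} (hv : ∀ α ∈ S, inner ℝ α v = 0)
    {g : O n} (hg : g ∈ reflClosure S) : g v = v := by
  induction hg using Subgroup.closure_induction with
  | mem x hx =>
    obtain ⟨α, hα, rfl⟩ := hx
    rw [refl_apply, hv α hα]; simp
  | one => rfl
  | mul x y _ _ hx hy => change x (y v) = v; rw [hy, hx]
  | inv x _ hx => exact (x.symm_apply_eq).2 hx.symm

theorem isReflectionGroup_reflClosure {G : Subgroup (O n)} [Finite G] {S : Set (E n)}
    (hS : S ⊆ normals G) : reflClosure S ≤ G ∧ IsReflectionGroup (reflClosure S) := by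
  have hle : reflClosure S ≤ G := by
    rw [reflClosure, Subgroup.closure_le]
    rintro _ ⟨α, hα, rfl⟩
    exact (hS hα).2
  refine ⟨hle, Finite.of_injective _ (Subgroup.inclusion_injective hle), le_antisymm ?_ ?_⟩
  · rw [Subgroup.closure_le]
    exact fun g hg => hg.1
  · refine Subgroup.closure_mono ?_
    rintro _ ⟨α, hα, rfl⟩
    exact ⟨Subgroup.subset_closure ⟨α, hα, rfl⟩, α, (hS hα).1, rfl⟩

theorem reflClosure_normals {G : Subgroup (O n)} (hG : IsReflectionGroup G) :
    reflClosure (normals G) = G := by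
  refine le_antisymm ?_ ?_
  · rw [reflClosure, Subgroup.closure_le]
    rintro _ ⟨α, hα, rfl⟩
    exact hα.2
  · conv_lhs => rw [← hG.2]
    refine Subgroup.closure_mono ?_
    rintro _ ⟨hg, α, hα, rfl⟩
    exact ⟨α, ⟨hα, hg⟩, rfl⟩

/-! ### Irreducibility in terms of normals -/

theorem refl_commute {α β : E n} (h : inner ℝ α β = 0) : Commute (refl α) (refl β) := by
  have hβ : refl α β = β := by rw [refl_apply, h]; simp
  have := refl_map (refl α) β
  rw [hβ, eq_mul_inv_iff_mul_eq] at this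
  exact this.symm

/-- The normals of an irreducible reflection group are not the union of two nonempty orthogonal
subsets. -/
theorem IsIrreducible.eq_empty_of_orthogonal {G : Subgroup (O n)} (hG : IsReflectionGroup G)
    (hirr : IsIrreducible G) {S T : Set (E n)} (hST : S ∪ T = normals G)
    (horth : ∀ α ∈ S, ∀ β ∈ T, inner ℝ α β = 0) (hS : S.Nonempty) : T = ∅ := by
  have := hG.1
  by_contra hT
  obtain ⟨β, hβ⟩ := Set.nonempty_iff_ne_empty.2 hT
  obtain ⟨α, hα⟩ := hS
  have hSs : S ⊆ normals G := hST ▸ Set.subset_union_left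
  have hTs : T ⊆ normals G := hST ▸ Set.subset_union_right
  refine hirr ⟨reflClosure S, reflClosure T, (isReflectionGroup_reflClosure hSs).2,
    (isReflectionGroup_reflClosure hTs).2, ?_, ?_, ?_, ?_, ?_⟩
  · exact fun h => refl_ne_one (hSs hα).1
      ((Subgroup.eq_bot_iff_forall _).1 h _ (Subgroup.subset_closure ⟨α, hα, rfl⟩))
  · exact fun h => refl_ne_one (hTs hβ).1
      ((Subgroup.eq_bot_iff_forall _).1 h _ (Subgroup.subset_closure ⟨β, hβ, rfl⟩))
  · intro g hg h hh
    have key : reflClosure S ≤ Subgroup.centralizer (reflClosure T : Set (O n)) := by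
      rw [reflClosure, Subgroup.closure_le, reflClosure, Subgroup.centralizer_closure]
      rintro _ ⟨a, ha, rfl⟩
      rw [SetLike.mem_coe, Subgroup.mem_centralizer_iff]
      rintro _ ⟨b, hb, rfl⟩
      exact (refl_commute (horth a ha b hb)).symm
    exact ((Subgroup.mem_centralizer_iff.1 (key hg)) h hh).symm
  · rw [Subgroup.eq_bot_iff_forall]
    rintro g ⟨hgS, hgT⟩
    ext1 x
    change g x = x
    -- The group of `T` fixes `span S`, the group of `S` fixes its complement; a common element
    -- fixes both.
    obtain ⟨a, ha, b, hb, rfl⟩ :=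
      (Submodule.span ℝ S).exists_add_mem_mem_orthogonal x
    rw [map_add]
    congr 1
    · refine reflClosure_fixes (fun c hc => ?_) hgT
      induction ha using Submodule.span_induction with
      | mem x hx => rw [real_inner_comm]; exact horth x hx c hc
      | zero => simp
      | add x y _ _ hx hy =>
        rw [inner_add_right, hx, hy, add_zero]
      | smul t x _ hx => rw [inner_smul_right, hx, mul_zero]
    · exact reflClosure_fixes (fun c hc => hb c (Submodule.subset_span hc)) hgS
  · conv_rhs => rw [← reflClosure_normals hG, ← hST]
    simp only [reflClosure, Set.image_union, Subgroup.closure_union]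

/-- In an irreducible essential reflection group, any two nonzero vectors have a common normal
to which neither is orthogonal. -/
theorem exists_normal_inner_ne_zero {G : Subgroup (O n)} (hG : IsReflectionGroup G)
    (hess : IsEssential G) (hirr : IsIrreducible G) {y z : E n} (hy : y ≠ 0) (hz : z ≠ 0) :
    ∃ β ∈ normals G, inner ℝ β y ≠ 0 ∧ inner ℝ β z ≠ 0 := by
  have hfix : ∀ v : E n, (∀ β ∈ normals G, inner ℝ β v = 0) → v = 0 := fun v hv =>
    hess v fun g hg => reflClosure_fixes hv (by rwa [reflClosure_normals hG])
  by_contra! hcon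
  have hyβ : ∃ β ∈ normals G, inner ℝ β y ≠ 0 := by
    by_contra! h
    exact hy (hfix y h)
  obtain ⟨β₀, hβ₀, hβ₀y⟩ := hyβ
  -- The new normal is `refl β γ`. So every normal outside `D` below is a combination of normals not
  -- orthogonal to `y`, hence orthogonal to `D`; irreducibility then leaves `D` empty.
  have hmove : ∀ β ∈ normals G, inner ℝ β y ≠ 0 → ∀ γ ∈ normals G, inner ℝ γ y = 0 →
      inner ℝ β γ ≠ 0 → ∃ c : ℝ, γ - c • β ∈ normals G ∧ inner ℝ (γ - c • β) y ≠ 0 := by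
    intro β hβ hβy γ hγ hγy hβγ
    refine ⟨2 * inner ℝ β γ / ‖β‖ ^ 2, ?_, ?_⟩
    · rw [← refl_apply]
      exact map_mem_normals hβ.2 hγ
    · rw [inner_sub_left, inner_smul_left, hγy, zero_sub, neg_ne_zero]
      simp [hβy, hβγ, hβ.1]
  let D : Set (E n) :=
    {δ | δ ∈ normals G ∧ ∀ β ∈ normals G, inner ℝ β y ≠ 0 → inner ℝ β δ = 0}
  have hself : ∀ β ∈ normals G, inner ℝ β y ≠ 0 → β ∉ D := fun β hβ hβy h =>
    hβ.1 (inner_self_eq_zero.1 (h.2 β hβ hβy))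
  have hDempty : D = ∅ := by
    refine hirr.eq_empty_of_orthogonal hG (S := normals G \ D) (T := D) ?_ ?_
      ⟨β₀, hβ₀, hself β₀ hβ₀ hβ₀y⟩
    · exact Set.sdiff_union_of_subset fun _ h => h.1
    · rintro γ ⟨hγ, hγD⟩ δ hδ
      by_cases hγy : inner ℝ γ y = 0
      · have : ∃ β ∈ normals G, inner ℝ β y ≠ 0 ∧ inner ℝ β γ ≠ 0 := by
          by_contra! h
          exact hγD ⟨hγ, h⟩
        obtain ⟨β, hβ, hβy, hβγ⟩ := this
        obtain ⟨c, hc, hcy⟩ := hmove β hβ hβy γ hγ hγy hβγ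
        have := hδ.2 _ hc hcy
        rwa [inner_sub_left, inner_smul_left, hδ.2 β hβ hβy, mul_zero, sub_zero] at this
      · exact hδ.2 γ hγ hγy
  -- Normals not orthogonal to `y` are orthogonal to `z` by `hcon`, and with `D` empty they span all
  -- normals.
  refine hz (hfix z fun γ hγ => ?_)
  by_cases hγy : inner ℝ γ y = 0
  · have : ∃ β ∈ normals G, inner ℝ β y ≠ 0 ∧ inner ℝ β γ ≠ 0 := by
      by_contra! h
      have : γ ∈ D := ⟨hγ, h⟩
      simp [hDempty] at this
    obtain ⟨β, hβ, hβy, hβγ⟩ := this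
    obtain ⟨c, hc, hcy⟩ := hmove β hβ hβy γ hγ hγy hβγ
    have := hcon _ hc hcy
    rwa [inner_sub_left, inner_smul_left, hcon β hβ hβy, mul_zero, sub_zero] at this
  · exact hcon γ hγ hγy

/-! ### Flats through a point -/

/-- The smallest flat of `G` that contains `p`. -/
noncomputable def minimalFlat (G : Subgroup (O n)) (p : E n) : Submodule ℝ (E n) :=
  sInf {H ∈ arrangement G | p ∈ H}

theorem mem_minimalFlat {G : Subgroup (O n)} {p v : E n} :
    v ∈ minimalFlat G p ↔ ∀ α ∈ normals G, inner ℝ α p = 0 → inner ℝ α v = 0 := by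
  simp only [minimalFlat, Submodule.mem_sInf]
  constructor
  · intro h α hα hp
    rw [← mem_orthogonal_span_singleton] at hp ⊢
    exact h _ ⟨⟨α, hα.1, hα.2, rfl⟩, hp⟩
  · rintro h _ ⟨⟨α, hα, hαG, rfl⟩, hp⟩
    rw [mem_orthogonal_span_singleton] at hp ⊢
    exact h α ⟨hα, hαG⟩ hp

theorem finrank_le_finrank_inf_orthogonal_add_one (X : Submodule ℝ (E n)) (α : E n) :
    Module.finrank ℝ X ≤ Module.finrank ℝ ↥((Submodule.span ℝ {α})ᗮ ⊓ X) + 1 := by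
  have h1 := Submodule.finrank_sup_add_finrank_inf_eq (Submodule.span ℝ {α})ᗮ X
  have h2 := (Submodule.span ℝ {α}).finrank_add_finrank_orthogonal
  have h3 := finrank_span_le_card (R := ℝ) {α}
  rw [Set.toFinset_singleton, Finset.card_singleton] at h3
  have h4 := Submodule.finrank_le ((Submodule.span ℝ {α})ᗮ ⊔ X)
  omega

/-- Cutting by one more hyperplane through `p` lowers the dimension by at most one, so every
dimension from `n` down to that of the minimal flat occurs among flats containing `p`. -/
theorem lt_finrank_minimalFlat {G : Subgroup (O n)} {p : E n} {l : ℕ} (hl : l ≤ n)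
    (hp : p ∉ stratum G l) : l < Module.finrank ℝ (minimalFlat G p) := by
  by_contra! hle
  let P : ℕ → Prop := fun m => l ≤ m ∧ ∃ S ⊆ {H ∈ arrangement G | p ∈ H},
    Module.finrank ℝ ↥(sInf S) = m
  have hex : ∃ m, P m := ⟨n, hl, ∅, Set.empty_subset _, by
    rw [sInf_empty, finrank_top, finrank_euclideanSpace_fin]⟩
  classical
  -- Take the least attained dimension that is at least `l`; if it exceeded `l`, one further cut
  -- would give a smaller one.
  obtain ⟨hlm, S, hS, hm⟩ := Nat.find_spec hex
  rcases hlm.eq_or_lt with h | h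
  · refine hp ⟨sInf S, ⟨S, fun H hH => (hS hH).1, rfl⟩, by rw [hm, ← h], ?_⟩
    exact Submodule.mem_sInf.2 fun H hH => (hS hH).2
  · have : ∃ H ∈ {H ∈ arrangement G | p ∈ H}, ¬ sInf S ≤ H := by
      by_contra! hc
      have := Submodule.finrank_mono (le_sInf hc)
      change _ ≤ Module.finrank ℝ (minimalFlat G p) at this
      omega
    obtain ⟨H, hH, hSH⟩ := this
    obtain ⟨α, -, -, rfl⟩ := hH.1
    have hlt : Module.finrank ℝ ↥((Submodule.span ℝ {α})ᗮ ⊓ sInf S) <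
        Module.finrank ℝ ↥(sInf S) :=
      Submodule.finrank_lt_finrank_of_lt (inf_le_right.lt_of_ne fun he => hSH (he ▸ inf_le_left))
    have hge := finrank_le_finrank_inf_orthogonal_add_one (sInf S) α
    refine Nat.find_min hex (m := Module.finrank ℝ ↥((Submodule.span ℝ {α})ᗮ ⊓ sInf S))
      (by omega) ⟨by omega, insert _ S, Set.insert_subset hH hS, by rw [sInf_insert]⟩

/-! ### Moving a point off the hyperplanes with normals in a subspace -/

/-- If `F` met `Uᗮ` trivially, the dimensions would force `F ⊔ Uᗮ = ⊤`, but `z` is orthogonal to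
both summands. -/
theorem exists_ne_zero_mem_orthogonal {F U : Submodule ℝ (E n)}
    (h : Module.finrank ℝ U ≤ Module.finrank ℝ F) {z : E n} (hzU : z ∈ U) (hz : z ≠ 0)
    (hzF : ∀ v ∈ F, inner ℝ z v = 0) : ∃ y ∈ F, y ≠ 0 ∧ ∀ u ∈ U, inner ℝ u y = 0 := by
  by_contra! hcon
  have hdisj : F ⊓ Uᗮ = ⊥ := by
    rw [Submodule.eq_bot_iff]
    rintro y ⟨hyF, hyU⟩
    by_contra hy
    obtain ⟨u, hu, hne⟩ := hcon y hyF hy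
    exact hne (hyU u hu)
  have h1 := Submodule.finrank_sup_add_finrank_inf_eq F Uᗮ
  rw [hdisj, finrank_bot] at h1
  have h2 := U.finrank_add_finrank_orthogonal
  have htop : F ⊔ Uᗮ = ⊤ := by
    refine Submodule.eq_top_of_finrank_eq (le_antisymm (Submodule.finrank_le _) ?_)
    omega
  have hz' : z ∈ F ⊔ Uᗮ := htop ▸ Submodule.mem_top
  obtain ⟨a, ha, b, hb, hab⟩ := Submodule.mem_sup.1 hz'
  have : inner ℝ z (a + b) = 0 := by rw [inner_add_right, hzF a ha, hb z hzU, add_zero]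
  rw [hab] at this
  exact hz (inner_self_eq_zero.1 this)

/-- If the smallest flat containing `p` has dimension at least `dim U`, then some point in the
orbit of `p` is orthogonal to no normal of `G` in `U`. -/
theorem exists_inner_map_ne_zero {G : Subgroup (O n)} (hG : IsReflectionGroup G)
    (hess : IsEssential G) (hirr : IsIrreducible G) {p : E n} {U : Submodule ℝ (E n)}
    (hU : Module.finrank ℝ U ≤ Module.finrank ℝ (minimalFlat G p)) :
    ∃ g ∈ G, ∀ γ ∈ normals G, γ ∈ U → inner ℝ γ (g p) ≠ 0 := by
  have := hG.1
  let Z : G → Set (E n) := fun g => {γ | γ ∈ normals G ∧ γ ∈ U ∧ inner ℝ γ (g.1 p) = 0}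
  obtain ⟨_, ⟨g, rfl⟩, hmin⟩ := (Set.finite_range Z).exists_minimal (Set.range_nonempty Z)
  refine ⟨g, g.2, fun z hz hzU hz0 => ?_⟩
  -- This transfers the dimension bound from `p` to `g p`.
  have hFle : (minimalFlat G p).map (g.1.toLinearEquiv : E n →ₗ[ℝ] E n) ≤
      minimalFlat G (g.1 p) := by
    rintro _ ⟨v, hv, rfl⟩
    refine mem_minimalFlat.2 fun α hα hαp => ?_
    have hmv : ∀ x, inner ℝ α (g.1 x) = inner ℝ (g.1⁻¹ α) x := fun x => by
      rw [← g.1.inner_map_map (g.1⁻¹ α) x]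
      congr 1
      exact (g.1.apply_symm_apply α).symm
    rw [hmv] at hαp
    exact (hmv v).trans (mem_minimalFlat.1 hv _ (map_mem_normals (G.inv_mem g.2) hα) hαp)
  have hF := Submodule.finrank_mono hFle
  rw [LinearEquiv.finrank_map_eq] at hF
  obtain ⟨y, hyF, hy, hyU⟩ := exists_ne_zero_mem_orthogonal (hU.trans hF) hzU hz.1
    fun v hv => mem_minimalFlat.1 hv z hz hz0
  obtain ⟨β, hβ, hβy, hβz⟩ := exists_normal_inner_ne_zero hG hess hirr hy hz.1
  -- If `γ` is orthogonal to `refl β (g p)`, then `refl β γ` is orthogonal to `g p`, hence to `y` in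
  -- its minimal flat. As `γ ∈ U` is orthogonal to `y` and `β` is not, `β` is orthogonal to `γ`, so
  -- `refl β` fixes `γ`. The new set thus lies in the old one and omits `z`.
  have hnew : ∀ γ ∈ Z (⟨refl β, hβ.2⟩ * g), inner ℝ β γ = 0 ∧ γ ∈ Z g := by
    rintro γ ⟨hγ, hγU, hγ0⟩
    change inner ℝ γ (refl β (g.1 p)) = 0 at hγ0
    rw [← refl_inner_comm] at hγ0
    have h := mem_minimalFlat.1 hyF _ (map_mem_normals hβ.2 hγ) hγ0
    rw [refl_apply, inner_sub_left, inner_smul_left, hyU γ hγU] at h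
    have hβγ : inner ℝ β γ = 0 := by simpa [hβy, hβ.1] using h
    rw [(refl_apply_eq_self_iff hβ.1 γ).2 hβγ] at hγ0
    exact ⟨hβγ, hγ, hγU, hγ0⟩
  have hz' := hmin ⟨_, rfl⟩ (fun γ hγ => (hnew γ hγ).2) (show z ∈ Z g from ⟨hz, hzU, hz0⟩)
  exact hβz (hnew z hz').1

/-! ### Degrees of invariants under conjugation -/

/-- The action of an orthogonal transformation on polynomials by substitution. -/
noncomputable def substHom (g : O n) :
    MvPolynomial (Fin n) ℝ →ₐ[ℝ] MvPolynomial (Fin n) ℝ :=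
  MvPolynomial.aeval fun i =>
    ∑ j, MvPolynomial.C (g (EuclideanSpace.single j 1) i) * MvPolynomial.X j

theorem apply_eq_sum (g : O n) (x : E n) (i : Fin n) :
    g x i = ∑ j, g (EuclideanSpace.single j 1) i * x j := by
  conv_lhs => rw [← (EuclideanSpace.basisFun (Fin n) ℝ).sum_repr x]
  simp [mul_comm]

theorem eval_substHom (g : O n) (x : E n) (f : MvPolynomial (Fin n) ℝ) :
    MvPolynomial.eval (fun i => x i) (substHom g f) = MvPolynomial.eval (fun i => g x i) f := by
  induction f using MvPolynomial.induction_on with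
  | C a => simp [substHom]
  | add p q hp hq => rw [map_add, map_add, map_add, hp, hq]
  | mul_X p i hp =>
    rw [map_mul, map_mul, map_mul, hp, MvPolynomial.eval_X, apply_eq_sum]
    simp [substHom]

theorem substHom_substHom_inv (g : O n) (f : MvPolynomial (Fin n) ℝ) :
    substHom g (substHom g⁻¹ f) = f := by
  refine MvPolynomial.funext fun x => ?_
  refine (eval_substHom g (WithLp.toLp 2 x) _).trans ?_
  rw [eval_substHom]
  change MvPolynomial.eval (fun i => g.symm (g _) i) f = _
  simp only [LinearIsometryEquiv.symm_apply_apply]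

theorem substHom_injective (g : O n) : Function.Injective (substHom g) :=
  Function.LeftInverse.injective (g := substHom g⁻¹) fun f => by
    simpa using substHom_substHom_inv g⁻¹ f

theorem isHomogeneous_substHom (g : O n) {f : MvPolynomial (Fin n) ℝ} {m : ℕ}
    (hf : f.IsHomogeneous m) : (substHom g f).IsHomogeneous m := by
  rw [← one_mul m]
  refine hf.aeval _ fun i => MvPolynomial.IsHomogeneous.sum _ _ _ fun j _ => ?_
  simpa using (MvPolynomial.isHomogeneous_C _ _).mul (MvPolynomial.isHomogeneous_X ℝ j)

theorem totalDegree_substHom (g : O n) {f : MvPolynomial (Fin n) ℝ}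
    (hf : f.IsHomogeneous f.totalDegree) : (substHom g f).totalDegree = f.totalDegree := by
  by_cases h : f = 0
  · simp [h]
  · exact (isHomogeneous_substHom g hf).totalDegree
      ((map_ne_zero_iff _ (substHom_injective g)).2 h)

/-- The conjugate `g⁻¹ W g`. -/
noncomputable def conjSubgroup (g : O n) (W : Subgroup (O n)) : Subgroup (O n) :=
  W.map (MulAut.conj g⁻¹).toMonoidHom

theorem mem_conjSubgroup {g h : O n} {W : Subgroup (O n)} :
    h ∈ conjSubgroup g W ↔ g * h * g⁻¹ ∈ W := by
  rw [conjSubgroup, Subgroup.mem_map]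
  constructor
  · rintro ⟨w, hw, rfl⟩
    simpa [mul_assoc] using hw
  · exact fun hh => ⟨_, hh, by simp [mul_assoc]⟩

theorem substHom_mem_invariants {g : O n} {W : Subgroup (O n)} {f : MvPolynomial (Fin n) ℝ}
    (hf : f ∈ invariants W) : substHom g f ∈ invariants (conjSubgroup g W) := by
  intro h hh x
  rw [eval_substHom, eval_substHom, ← hf _ (mem_conjSubgroup.1 hh) (g x)]
  change MvPolynomial.eval (fun i => g (h x) i) f =
    MvPolynomial.eval (fun i => g (h (g.symm (g x))) i) f
  rw [g.symm_apply_apply]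

theorem conjSubgroup_inv_conjSubgroup (g : O n) (W : Subgroup (O n)) :
    conjSubgroup g⁻¹ (conjSubgroup g W) = W := by
  ext h
  simp [mem_conjSubgroup, mul_assoc]

theorem IsBasicInvariants.conj {W : Subgroup (O n)} {π : Fin n → MvPolynomial (Fin n) ℝ}
    (hπ : IsBasicInvariants W π) (g : O n) :
    IsBasicInvariants (conjSubgroup g W) (substHom g ∘ π) where
  homogeneous i := by
    rw [Function.comp_apply, totalDegree_substHom g (hπ.homogeneous i)]
    exact isHomogeneous_substHom g (hπ.homogeneous i)
  algebraicIndependent := hπ.algebraicIndependent.map' (substHom_injective g)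
  generate := by
    rw [Set.range_comp, Algebra.adjoin_image, hπ.generate]
    refine le_antisymm ?_ fun f hf => ?_
    · rintro _ ⟨f, hf, rfl⟩
      exact substHom_mem_invariants hf
    · refine ⟨substHom g⁻¹ f, ?_, substHom_substHom_inv g f⟩
      have := substHom_mem_invariants (g := g⁻¹) hf
      rwa [conjSubgroup_inv_conjSubgroup] at this

/-- Substitution by `g` carries basic invariants of `W` to those of `g⁻¹ W g` with the same degrees,
and `g⁻¹` reverses this; the two suprema run over equal sets, even if these were empty. -/
theorem topDegree_conjSubgroup (g : O n) (W : Subgroup (O n)) :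
    topDegree (conjSubgroup g W) = topDegree W := by
  have key : ∀ (g : O n) (W : Subgroup (O n)) (e : ℕ),
      (∃ π : Fin n → MvPolynomial (Fin n) ℝ,
        IsBasicInvariants W π ∧ ∃ i, e = (π i).totalDegree) →
      ∃ π : Fin n → MvPolynomial (Fin n) ℝ,
        IsBasicInvariants (conjSubgroup g W) π ∧ ∃ i, e = (π i).totalDegree := by
    rintro g W e ⟨π, hπ, i, rfl⟩
    exact ⟨_, hπ.conj g, i, (totalDegree_substHom g (hπ.homogeneous i)).symm⟩
  unfold topDegree
  congr 1
  ext e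
  refine ⟨fun h => ?_, key g W e⟩
  have := key g⁻¹ _ e h
  rwa [conjSubgroup_inv_conjSubgroup] at this

/-! ### Conjugate parabolic subgroups and the bound -/

theorem conjSubgroup_reflClosure (g : O n) (S : Set (E n)) :
    conjSubgroup g (reflClosure S) = reflClosure ((g⁻¹ : O n) '' S) := by
  rw [conjSubgroup, reflClosure, MonoidHom.map_closure, reflClosure, Set.image_image,
    Set.image_image]
  congr 1
  refine Set.image_congr fun α _ => ?_
  rw [refl_map]
  simp

theorem parabolic_eq_reflClosure (I : Finset (E n)) :
    parabolic I = reflClosure (I : Set (E n)) := by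
  rw [parabolic, reflClosure]
  congr 1
  ext g
  simp [eq_comm]

/-- The group fixes the orthogonal complement of `S` pointwise, so the normal of any reflection in
it is orthogonal to that complement. -/
theorem mem_span_of_refl_mem_reflClosure {S : Set (E n)} {α : E n} (hα : α ≠ 0)
    (h : refl α ∈ reflClosure S) : α ∈ Submodule.span ℝ S := by
  rw [← (Submodule.span ℝ S).orthogonal_orthogonal]
  refine (Submodule.mem_orthogonal' _ _).2 fun v hv => ?_
  rw [← refl_apply_eq_self_iff hα]
  exact reflClosure_fixes (fun β hβ => hv β (Submodule.subset_span hβ)) h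

theorem strataNumber_le_parabolicNumber {G : Subgroup (O n)} (hG : IsReflectionGroup G)
    (hess : IsEssential G) (hirr : IsIrreducible G) {Δ : Finset (E n)}
    (hΔ : IsSimpleSystem G Δ) (d : ℕ) :
    (strataNumber G d : ℕ∞) ≤ parabolicNumber Δ d := by
  have := hG.1
  refine le_sInf ?_
  rintro _ ⟨I, hI, hne, hd, rfl⟩
  rw [parabolic_eq_reflClosure] at hd
  have hIG : (I : Set (E n)) ⊆ normals G := fun α hα => by
    obtain ⟨h1, h2⟩ := hΔ.subset_roots α (hI hα)
    exact ⟨fun h => by simp [h] at h1, h2⟩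
  have hcard : Module.finrank ℝ (Submodule.span ℝ (I : Set (E n))) ≤ I.card :=
    finrank_span_finset_le_card I
  have hIn : I.card ≤ n := by
    have hli : LinearIndependent ℝ (fun α : I => (α : E n)) :=
      hΔ.linearIndependent.comp (Set.inclusion hI) (Set.inclusion_injective hI)
    simpa using hli.fintype_card_le_finrank
  refine Nat.cast_le.2 (Nat.sInf_le fun p hp => ?_)
  have hpos := hne.card_pos
  have hF := lt_finrank_minimalFlat (by omega) hp
  obtain ⟨g, hg, hgen⟩ := exists_inner_map_ne_zero hG hess hirr
    (U := Submodule.span ℝ (I : Set (E n))) (p := p) (by omega)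
  have hsub : (g⁻¹ : O n) '' (I : Set (E n)) ⊆ normals G := by
    rintro _ ⟨α, hα, rfl⟩
    exact map_mem_normals (G.inv_mem hg) (hIG hα)
  obtain ⟨hle, hrefl⟩ := isReflectionGroup_reflClosure hsub
  rw [← conjSubgroup_reflClosure] at hle hrefl
  refine ⟨conjSubgroup g (reflClosure I), hle, hrefl, ?_, by rwa [topDegree_conjSubgroup]⟩
  -- If `refl α` lies in the conjugate, then `refl (g α)` lies in `W_I`, so `g α` is in `span I` and
  -- is not orthogonal to `g p`.
  rintro _ ⟨α, hα, hαW, rfl⟩ hαp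
  rw [mem_orthogonal_span_singleton, ← g.inner_map_map] at hαp
  refine hgen (g α) (map_mem_normals hg ⟨hα, hle hαW⟩) ?_ hαp
  rw [mem_conjSubgroup, ← refl_map] at hαW
  exact mem_span_of_refl_mem_reflClosure (fun h => hα (g.map_eq_zero_iff.1 h)) hαW

end ReflGrp

theorem corollary5p3 (n : ℕ) (hn : 1 ≤ n)
    (G : Subgroup (ReflGrp.O n)) (hG : ReflGrp.IsReflectionGroup G)
    (hess : ReflGrp.IsEssential G) (hirr : ReflGrp.IsIrreducible G)
    (Δ : Finset (ReflGrp.E n)) (hΔ : ReflGrp.IsSimpleSystem G Δ) (d : ℕ) :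
    (ReflGrp.strataNumber G d : ℕ∞) ≤ ReflGrp.parabolicNumber Δ d := by
  exact ReflGrp.strataNumber_le_parabolicNumber hG hess hirr hΔ d
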